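/- Let $G$ be a connected (real, finite-dimensional, Hausdorff) Lie group with Lie algebra $\mathfrak g$. Let $\mathcal X$ be a linear vector field on $G$, that is, a smooth vector field whose flow $(\varphi_t)_{t\in\mathbb R}$ is defined for all times and consists of Lie group automorphisms of $G$, and let $\mathcal D:\mathfrak g\to\mathfrak g$, $\mathcal D(Y)=-[\mathcal X,Y]$, be its derivation. An eigenvalue of (the complexification of) $\mathcal D$ is called semisimple if all its complex Jordan blocks are one-dimensional. A point $g\in G$ has a periodic orbit with period $T>0$ if $g$ is not a fixed point of the flow and $\varphi_{t+T}(g)=\varphi_t(g)$ for all $t\in\mathbb R$. Suppose that the nonzero complex eigenvalues of $\mathcal D$ are exactly $\pm\alpha_1 i,\dots,\pm\alpha_r i$ with $r\ge 0$ and nonzero real numbers $\alpha_1,\dots,\alpha_r$, that these eigenvalues are semisimple, and that $\alpha_i/\alpha_j\in\mathbb Q$ for all $i,j=1,\dots,r$. Then: (1) if $r\ge 1$, i.e. if $\mathcal D$ has a nonzero eigenvalue, then $\varphi_t$ has a periodic orbit; (2) if moreover the eigenvalue $0$ (in case it occurs) is semisimple, then there is a $T>0$ such that the orbit of every point $g\in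 G$ that is not a fixed point of the flow is periodic with period $T$. -/

import Mathlib

open scoped Manifold ContDiff TensorProduct

noncomputable section

namespace LinearFlow

section LieGroupNotions

variable {E : Type*} [NormedAddCommGroup E] [NormedSpace ℝ E]
  {H : Type*} [TopologicalSpace H] (I : ModelWithCorners ℝ E H)
  {G : Type*} [TopologicalSpace G] [ChartedSpace H G]

/-- `φ` is the (globally defined) flow of the vector field `X`: for every `g`, the curve
`t ↦ φ t g` is the integral curve of `X` with value `g` at time `0`. -/
structure IsFlow (X : (g : G) → TangentSpace I g) (φ : ℝ → G → G) : Prop where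
  map_zero : ∀ g, φ 0 g = g
  isIntegralCurve : ∀ g, IsMIntegralCurve (I := I) (fun t => φ t g) X

variable [Group G]

/-- `f` is an automorphism of the Lie group `G`: a group automorphism which is smooth, with smooth
inverse. -/
def IsLieGroupAut (f : G → G) : Prop :=
  ∃ e : G ≃* G, ⇑e = f ∧ ContMDiff I I ∞ e ∧ ContMDiff I I ∞ e.symm

/-- A linear vector field on a Lie group: a smooth vector field whose flow (defined for all times)
is a family of automorphisms of the Lie group. -/
def IsLinearVectorField [LieGroup I ∞ G] (X : (g : G) → TangentSpace I g) : Prop :=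
  ContMDiff I I.tangent ∞ (fun g => (⟨g, X g⟩ : TangentBundle I G)) ∧
    ∃ φ : ℝ → G → G, IsFlow I X φ ∧ ∀ t, IsLieGroupAut I (φ t)

instance lieGroup_minSmoothness [LieGroup I ∞ G] : LieGroup I (minSmoothness ℝ 3) G :=
  LieGroup.of_le (n := ∞) (by simp only [minSmoothness_of_isRCLikeNormedField]; exact ENat.LEInfty.out)

/-- The derivation `𝒟 = -ad X` of the Lie algebra of `G` associated with a linear vector field `X`:
`𝒟 Y = -[X, Y]`. The Lie algebra is the tangent space at the identity, `Y` is extended to an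
invariant vector field, and the bracket of vector fields is evaluated at the identity. -/
def derivation [FiniteDimensional ℝ E] [LieGroup I ∞ G] (X : (g : G) → TangentSpace I g) :
    GroupLieAlgebra I G →ₗ[ℝ] GroupLieAlgebra I G where
  toFun Y := -VectorField.mlieBracket I X (mulInvariantVectorField Y) (1 : G)
  map_add' Y Z := by
    have := FiniteDimensional.complete ℝ E
    rw [mulInvariantVectorField_add, VectorField.mlieBracket_add_right
      (mdifferentiableAt_mulInvariantVectorField _) (mdifferentiableAt_mulInvariantVectorField _),
      neg_add]
  map_smul' c Y := by
    have := FiniteDimensional.complete ℝ E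
    rw [mulInvariantVectorField_smul, VectorField.mlieBracket_const_smul_right
      (mdifferentiableAt_mulInvariantVectorField _), RingHom.id_apply, smul_neg]

end LieGroupNotions

section Eigenvalues

variable {V : Type*} [AddCommGroup V] [Module ℝ V]

/-- `μ` is a complex eigenvalue of the real endomorphism `D`, that is, an eigenvalue of its
complexification. -/
def IsComplexEigenvalue (D : V →ₗ[ℝ] V) (μ : ℂ) : Prop :=
  Module.End.HasEigenvalue (D.baseChange ℂ : Module.End ℂ (ℂ ⊗[ℝ] V)) μ

/-- All complex Jordan blocks of `D` for `μ` are one-dimensional: every generalized eigenvector of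
the complexification of `D` for `μ` is an eigenvector. -/
def IsSemisimpleAt (D : V →ₗ[ℝ] V) (μ : ℂ) : Prop :=
  Module.End.maxGenEigenspace (D.baseChange ℂ : Module.End ℂ (ℂ ⊗[ℝ] V)) μ =
    Module.End.eigenspace (D.baseChange ℂ : Module.End ℂ (ℂ ⊗[ℝ] V)) μ

end Eigenvalues

section Orbits

variable {G : Type*}

/-- `g` is a fixed point of the flow `φ`. -/
def IsFixedPoint (φ : ℝ → G → G) (g : G) : Prop :=
  ∀ t, φ t g = g

/-- The orbit of `g` under the flow `φ` is periodic with period `T`. Fixed points are not counted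
as periodic orbits. -/
def IsPeriodicOrbit (φ : ℝ → G → G) (g : G) (T : ℝ) : Prop :=
  ¬ IsFixedPoint φ g ∧ 0 < T ∧ ∀ t, φ (t + T) g = φ t g

end Orbits

end LinearFlow

end

namespace LinearFlow

section LinearAlgebra

variable {V : Type*} [AddCommGroup V] [Module ℝ V]

/-- The kernel of `P` controls that of `N` also after complexification. -/
theorem baseChange_apply_eq_zero_of_ker_le {P N : V →ₗ[ℝ] V}
    (h : LinearMap.ker P ≤ LinearMap.ker N) {v : ℂ ⊗[ℝ] V} (hv : P.baseChange ℂ v = 0) :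
    N.baseChange ℂ v = 0 := by
  obtain ⟨R, hR⟩ := ((LinearMap.ker P).liftQ P le_rfl).exists_leftInverse_of_injective
    (Submodule.ker_liftQ_eq_bot _ _ _ le_rfl)
  have hQ : N = ((LinearMap.ker P).liftQ N h ∘ₗ R) ∘ₗ P := by
    ext x
    have := LinearMap.congr_fun hR ((LinearMap.ker P).mkQ x)
    simp only [LinearMap.comp_apply, Submodule.mkQ_apply, Submodule.liftQ_apply,
      LinearMap.id_apply] at this
    simp only [LinearMap.comp_apply, this, Submodule.liftQ_apply]
  rw [hQ, LinearMap.baseChange_comp, LinearMap.comp_apply, hv, map_zero]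

theorem baseChange_sq_add_apply (D : V →ₗ[ℝ] V) (a : ℝ) (v : ℂ ⊗[ℝ] V) :
    (D ∘ₗ D + a ^ 2 • LinearMap.id).baseChange ℂ v =
      D.baseChange ℂ (D.baseChange ℂ v) + (a : ℂ) ^ 2 • v := by
  induction v using TensorProduct.induction_on with
  | zero => simp only [map_zero, smul_zero, add_zero]
  | add x y hx hy => simp only [map_add, smul_add, hx, hy]; abel
  | tmul z x =>
    simp only [LinearMap.baseChange_tmul, LinearMap.add_apply, LinearMap.comp_apply,
      LinearMap.smul_apply, LinearMap.id_apply, TensorProduct.tmul_add, TensorProduct.smul_tmul',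
      ← TensorProduct.smul_tmul]
    simp [Algebra.smul_def]

theorem baseChange_sq_add_apply_eq_zero {D : V →ₗ[ℝ] V} {a : ℝ} {μ : ℂ} (hμ : μ ^ 2 = -(a : ℂ) ^ 2)
    {v : ℂ ⊗[ℝ] V} (hv : D.baseChange ℂ v = μ • v) :
    (D ∘ₗ D + a ^ 2 • LinearMap.id).baseChange ℂ v = 0 := by
  rw [baseChange_sq_add_apply, hv, map_smul, hv, smul_smul, ← pow_two, hμ, neg_smul,
    neg_add_cancel]

theorem exists_apply_apply_eq_neg_sq_smul {D : V →ₗ[ℝ] V} {a : ℝ}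
    (h : IsComplexEigenvalue D (a * Complex.I)) : ∃ Y : V, Y ≠ 0 ∧ D (D Y) = -(a ^ 2 • Y) := by
  obtain ⟨v, hv, hv0⟩ := h.exists_hasEigenvector
  rw [Module.End.mem_eigenspace_iff] at hv
  by_contra! hcon
  refine hv0 ?_
  have hker : LinearMap.ker (D ∘ₗ D + a ^ 2 • LinearMap.id) ≤
      LinearMap.ker (LinearMap.id : V →ₗ[ℝ] V) := by
    intro Y hY
    by_contra hY0
    refine hcon Y hY0 ?_
    simpa [← eq_neg_iff_add_eq_zero] using hY
  simpa using baseChange_apply_eq_zero_of_ker_le hker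
    (baseChange_sq_add_apply_eq_zero (by rw [mul_pow, Complex.I_sq, mul_neg_one]) hv)

theorem iSup_eigenspace_eq_top {K W : Type*} [Field K] [IsAlgClosed K] [AddCommGroup W] [Module K W]
    [FiniteDimensional K W] (f : Module.End K W)
    (h : ∀ μ, f.HasEigenvalue μ → f.maxGenEigenspace μ = f.eigenspace μ) :
    ⨆ μ, f.eigenspace μ = ⊤ := by
  rw [← Module.End.iSup_maxGenEigenspace_eq_top f]
  refine iSup_congr fun μ => ?_
  by_cases hμ : f.HasEigenvalue μ
  · exact (h μ hμ).symm
  · have h1 : f.maxGenEigenspace μ = ⊥ := by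
      by_contra h
      exact hμ (Module.End.HasUnifEigenvalue.lt (k := ⊤) one_pos h)
    rw [h1]
    rw [Module.End.hasEigenvalue_iff, not_not] at hμ
    exact hμ

/-- If `D` is semisimple, with complex eigenvalues `0` and `±a i` for `a ∈ S`, then an endomorphism
vanishing on the kernel of `D` and on those of the `D² + a²` is zero. -/
theorem eq_zero_of_ker_le [FiniteDimensional ℝ V] {D N : V →ₗ[ℝ] V} {S : Set ℝ}
    (hS : ∀ μ : ℂ, μ ≠ 0 → IsComplexEigenvalue D μ →
      ∃ a ∈ S, μ = (a : ℂ) * Complex.I ∨ μ = -((a : ℂ) * Complex.I))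
    (hss : ∀ μ : ℂ, IsComplexEigenvalue D μ → IsSemisimpleAt D μ)
    (h0 : LinearMap.ker D ≤ LinearMap.ker N)
    (hN : ∀ a ∈ S, ∀ Y, D (D Y) = -(a ^ 2 • Y) → N Y = 0) : N = 0 := by
  have hsup := iSup_eigenspace_eq_top (D.baseChange ℂ : Module.End ℂ (ℂ ⊗[ℝ] V)) hss
  have hz : LinearMap.ker (N.baseChange ℂ) = ⊤ := by
    rw [eq_top_iff, ← hsup]
    refine iSup_le fun μ v hv => ?_
    rw [Module.End.mem_eigenspace_iff] at hv
    rw [LinearMap.mem_ker]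
    by_cases hv0 : v = 0
    · simp [hv0]
    have hμ : IsComplexEigenvalue D μ := Module.End.hasEigenvalue_of_hasEigenvector
      ⟨Module.End.mem_eigenspace_iff.2 hv, hv0⟩
    by_cases hμ0 : μ = 0
    · refine baseChange_apply_eq_zero_of_ker_le h0 ?_
      rw [hv, hμ0, zero_smul]
    · obtain ⟨a, ha, haμ⟩ := hS μ hμ0 hμ
      have hsq : μ ^ 2 = -(a : ℂ) ^ 2 := by
        rcases haμ with rfl | rfl <;> simp [mul_pow]
      refine baseChange_apply_eq_zero_of_ker_le ?_ (baseChange_sq_add_apply_eq_zero hsq hv)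
      intro Y hY
      exact hN a ha Y (by simpa [← eq_neg_iff_add_eq_zero] using hY)
  ext x
  refine Module.Flat.tensorProduct_mk_injective (R := ℝ) V ℂ ?_
  have : (1 : ℂ) ⊗ₜ[ℝ] x ∈ LinearMap.ker (N.baseChange ℂ) := hz ▸ Submodule.mem_top
  rw [LinearMap.mem_ker, LinearMap.baseChange_tmul] at this
  simpa using this

/-- Commensurable nonzero reals have a common period. -/
theorem exists_common_period {r : ℕ} {α : Fin r → ℝ} (hα : ∀ j, α j ≠ 0)
    (hrat : ∀ i j, ∃ q : ℚ, α i / α j = (q : ℝ)) :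
    ∃ T : ℝ, 0 < T ∧ ∀ j, ∃ n : ℤ, α j * T = n * (2 * Real.pi) := by
  rcases Nat.eq_zero_or_pos r with rfl | hr
  · exact ⟨1, one_pos, fun j => j.elim0⟩
  let i₀ : Fin r := ⟨0, hr⟩
  choose q hq using fun j => hrat j i₀
  have hN : (0 : ℝ) < ∏ j, ((q j).den : ℝ) :=
    Finset.prod_pos fun j _ => by exact_mod_cast (q j).den_pos
  refine ⟨2 * Real.pi * (∏ j, ((q j).den : ℝ)) / |α i₀|, ?_, fun j => ?_⟩
  · have := abs_pos.2 (hα i₀); positivity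
  obtain ⟨ε, hε⟩ : ∃ ε : ℤ, α i₀ / |α i₀| = ε := by
    rcases lt_or_gt_of_ne (hα i₀) with h | h
    · exact ⟨-1, by rw [abs_of_neg h, div_neg, div_self h.ne]; simp⟩
    · exact ⟨1, by rw [abs_of_pos h, div_self h.ne']; simp⟩
  refine ⟨ε * (q j).num * ∏ k ∈ Finset.univ.erase j, ((q k).den : ℤ), ?_⟩
  have h1 : α j = q j * α i₀ := by rw [← hq j]; field_simp [hα i₀]
  rw [h1, ← Finset.mul_prod_erase Finset.univ _ (Finset.mem_univ j)]
  have h2 : ((q j : ℚ) : ℝ) * (q j).den = (q j).num := by exact_mod_cast Rat.mul_den_eq_num (q j)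
  push_cast
  rw [← h2, ← hε]
  ring

end LinearAlgebra

section Linearization

variable {E : Type*} [NormedAddCommGroup E] [NormedSpace ℝ E]

theorem norm_sub_le_mul_exp {u u' : ℝ → E} {p : E} {L T : ℝ}
    (hu : ∀ t ∈ Set.Icc 0 T, HasDerivAt u (u' t) t)
    (hL : ∀ t ∈ Set.Icc 0 T, ‖u' t‖ ≤ L * ‖u t - p‖) :
    ∀ t ∈ Set.Icc 0 T, ‖u t - p‖ ≤ ‖u 0 - p‖ * Real.exp (L * t) := by
  intro t ht
  have := norm_le_gronwallBound_of_norm_deriv_right_le (f := fun t => u t - p) (f' := u')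
    (δ := ‖u 0 - p‖) (K := L) (ε := 0) (a := 0) (b := T)
    (fun t ht => ((hu t ht).sub_const p).continuousAt.continuousWithinAt)
    (fun t ht => ((hu t (Set.Ico_subset_Icc_self ht)).sub_const p).hasDerivWithinAt) le_rfl
    (fun t ht => by simpa using hL t (Set.Ico_subset_Icc_self ht)) t ht
  simpa [gronwallBound_ε0] using this

/-- A solution of an ODE which is close to linear stays close to the solution of the linear ODE. -/
theorem norm_sub_linear_solution_le {f : E → E} {D : E →L[ℝ] E} {p : E} {η M T s : ℝ} {u c : ℝ → E}
    (hM : 0 ≤ η * M) (hη : 0 ≤ η)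
    (hu : ∀ t ∈ Set.Icc 0 T, HasDerivAt u (f (u t)) t)
    (hf : ∀ t ∈ Set.Icc 0 T, ‖f (u t) - D (u t - p)‖ ≤ η * ‖u t - p‖)
    (huM : ∀ t ∈ Set.Icc 0 T, ‖u t - p‖ ≤ M)
    (hc : ∀ t, HasDerivAt c (D (c t)) t) (h0 : u 0 = p + s • c 0) :
    ∀ t ∈ Set.Icc 0 T, ‖u t - p - s • c t‖ ≤ η * M * Real.exp ((‖D‖ + 1) * t) := by
  intro t ht
  have hd : ∀ t ∈ Set.Icc 0 T,
      HasDerivAt (fun t => u t - p - s • c t) (f (u t) - s • D (c t)) t := fun t ht =>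
    ((hu t ht).sub_const p).sub ((hc t).const_smul s)
  have := norm_le_gronwallBound_of_norm_deriv_right_le (f := fun t => u t - p - s • c t)
    (f' := fun t => f (u t) - s • D (c t))
    (δ := 0) (K := ‖D‖ + 1) (ε := η * M) (a := 0) (b := T)
    (fun t ht => (hd t ht).continuousAt.continuousWithinAt)
    (fun t ht => (hd t (Set.Ico_subset_Icc_self ht)).hasDerivWithinAt) (by simp [h0])
    (fun t ht => by
      have ht' := Set.Ico_subset_Icc_self ht
      have e : f (u t) - s • D (c t) = (f (u t) - D (u t - p)) + D (u t - p - s • c t) := by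
        simp only [map_sub, map_smul]; abel
      have h1 := hf t ht'
      have h2 := mul_le_mul_of_nonneg_left (huM t ht') hη
      have h3 := D.le_opNorm (u t - p - s • c t)
      have h4 := norm_nonneg (u t - p - s • c t)
      calc ‖f (u t) - s • D (c t)‖ ≤ ‖f (u t) - D (u t - p)‖ + ‖D (u t - p - s • c t)‖ := by
            rw [e]; exact norm_add_le _ _
        _ ≤ (‖D‖ + 1) * ‖u t - p - s • c t‖ + η * M := by linarith) t ht
  have hK : ‖D‖ + 1 ≠ 0 := by positivity
  rw [sub_zero, gronwallBound_of_K_ne_0 hK] at this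
  have hK1 : 1 ≤ ‖D‖ + 1 := by linarith [norm_nonneg D]
  refine this.trans ?_
  have h1 : η * M / (‖D‖ + 1) ≤ η * M := div_le_self hM hK1
  have h2 : 0 ≤ Real.exp ((‖D‖ + 1) * t) - 1 := by
    have := Real.one_le_exp (x := (‖D‖ + 1) * t) (mul_nonneg (by positivity) ht.1); linarith
  have h3 := mul_le_mul_of_nonneg_right h1 h2
  simp only [zero_mul, zero_add]
  linarith

end Linearization

section ManifoldFlow

variable {E : Type*} [NormedAddCommGroup E] [NormedSpace ℝ E]
  {H : Type*} [TopologicalSpace H] {I : ModelWithCorners ℝ E H}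
  {M : Type*} [TopologicalSpace M] [ChartedSpace H M]

variable (I) in
/-- The vector field `X` in the chart at `x₀`. -/
noncomputable def chartField (X : (x : M) → TangentSpace I x) (x₀ : M) : E → E :=
  VectorField.mpullbackWithin 𝓘(ℝ, E) I (extChartAt I x₀).symm X (Set.range I)

variable [IsManifold I 1 M]

theorem hasDerivAt_extChartAt_comp {X : (x : M) → TangentSpace I x} {γ : ℝ → M}
    (hγ : IsMIntegralCurve (I := I) γ X) (x₀ : M) {t : ℝ} (ht : γ t ∈ (extChartAt I x₀).source) :
    HasDerivAt (fun s => extChartAt I x₀ (γ s)) (chartField I X x₀ (extChartAt I x₀ (γ t))) t := by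
  have hsrc : γ t ∈ (chartAt H x₀).source := by rwa [extChartAt_source] at ht
  obtain ⟨A, hA⟩ : ∃ A : E →L[ℝ] E, A = mfderiv I 𝓘(ℝ, E) (extChartAt I x₀) (γ t) := ⟨_, rfl⟩
  obtain ⟨w, hw⟩ : ∃ w : E, w = X (γ t) := ⟨_, rfl⟩
  have h1 : HasFDerivAt (extChartAt I x₀ ∘ γ)
      (A.comp (ContinuousLinearMap.smulRight (1 : ℝ →L[ℝ] ℝ) w)) t := by
    rw [hA, hw]
    exact hasMFDerivAt_iff_hasFDerivAt.1
      ((mdifferentiableAt_extChartAt (I := I) hsrc).hasMFDerivAt.comp t (hγ t))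
  have h2 := ContinuousLinearMap.inverse_eq
    (mfderivWithin_extChartAt_symm_comp_mfderiv_extChartAt' (I := I) ht)
    (mfderiv_extChartAt_comp_mfderivWithin_extChartAt_symm' (I := I) ht)
  have h3 : ∀ z, z = γ t → ∀ B : E →L[ℝ] E, B = A → B (X z) = A w := by
    rintro _ rfl B rfl; rw [hw]
  have h4 : chartField I X x₀ (extChartAt I x₀ (γ t)) = A w :=
    h3 _ ((extChartAt I x₀).left_inv ht) _ (h2.trans hA.symm)
  rw [h4]
  exact h1.hasDerivAt.congr_deriv (by simp)

variable [T2Space M] [FiniteDimensional ℝ E]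

/-- Integral curves starting close to a zero of the vector field stay close to it. -/
theorem integralCurve_mem_source {X : (x : M) → TangentSpace I x} {x₀ : M} {ρ L T : ℝ}
    (hL : 0 ≤ L)
    (hρ : Metric.closedBall (extChartAt I x₀ x₀) ρ ⊆ (extChartAt I x₀).target)
    (hX : ∀ y ∈ Metric.closedBall (extChartAt I x₀ x₀) ρ,
      ‖chartField I X x₀ y‖ ≤ L * ‖y - extChartAt I x₀ x₀‖)
    {γ : ℝ → M} (hγ : IsMIntegralCurve (I := I) γ X) (h0 : γ 0 ∈ (extChartAt I x₀).source)
    (h0ρ : ‖extChartAt I x₀ (γ 0) - extChartAt I x₀ x₀‖ * Real.exp (L * T) < ρ) :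
    ∀ t ∈ Set.Icc 0 T, γ t ∈ (extChartAt I x₀).source ∧
      ‖extChartAt I x₀ (γ t) - extChartAt I x₀ x₀‖ ≤
        ‖extChartAt I x₀ (γ 0) - extChartAt I x₀ x₀‖ * Real.exp (L * t) := by
  set ψ := extChartAt I x₀ with hψ
  set p := ψ x₀
  set K : Set M := ψ.symm '' Metric.closedBall p ρ
  have hKc : IsClosed K := ((isCompact_closedBall p ρ).image_of_continuousOn
    ((continuousOn_extChartAt_symm x₀).mono hρ)).isClosed
  have hK : ∀ x ∈ K, x ∈ ψ.source ∧ ψ x ∈ Metric.closedBall p ρ := by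
    rintro _ ⟨y, hy, rfl⟩
    refine ⟨ψ.map_target (hρ hy), ?_⟩
    rwa [ψ.right_inv (hρ hy)]
  have hγc : Continuous γ := hγ.continuous
  have key : ∀ t₁, (∀ s ∈ Set.Icc 0 t₁, γ s ∈ K) → ∀ t ∈ Set.Icc 0 t₁, γ t ∈ ψ.source ∧
      ‖ψ (γ t) - p‖ ≤ ‖ψ (γ 0) - p‖ * Real.exp (L * t) := fun t₁ h t ht =>
    ⟨(hK _ (h t ht)).1, norm_sub_le_mul_exp (u := fun s => ψ (γ s))
      (fun s hs => hasDerivAt_extChartAt_comp hγ x₀ (hK _ (h s hs)).1)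
      (fun s hs => hX _ (hK _ (h s hs)).2) t ht⟩
  set O : Set M := ψ.source ∩ ψ ⁻¹' Metric.ball p ρ
  have hO : IsOpen O := isOpen_extChartAt_preimage' x₀ Metric.isOpen_ball
  have hOK : O ⊆ K := fun x hx => ⟨ψ x, Metric.ball_subset_closedBall hx.2, ψ.left_inv hx.1⟩
  refine key T fun s hs => hOK ?_
  by_contra hsO
  obtain ⟨t₁, ⟨⟨ht₁, ht₁O⟩, hmin⟩⟩ :=
    (isCompact_Icc.inter_right (hO.preimage hγc).isClosed_compl).exists_isLeast ⟨s, hs, hsO⟩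
  have hlt : ∀ t ∈ Set.Ico 0 t₁, γ t ∈ O := by
    intro t ht
    by_contra h
    exact absurd (hmin ⟨⟨ht.1, ht.2.le.trans ht₁.2⟩, h⟩) (not_le.2 ht.2)
  have h0O : γ 0 ∈ O := by
    refine ⟨h0, ?_⟩
    rw [Set.mem_preimage, mem_ball_iff_norm]
    refine lt_of_le_of_lt (le_mul_of_one_le_right (norm_nonneg _) ?_) h0ρ
    exact Real.one_le_exp (mul_nonneg hL (ht₁.1.trans ht₁.2))
  have hpos : 0 < t₁ := by
    rcases ht₁.1.eq_or_lt with h | h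
    · rw [← h] at ht₁O; exact absurd h0O ht₁O
    · exact h
  have hK1 : ∀ t ∈ Set.Icc 0 t₁, γ t ∈ K := by
    intro t ht
    rw [← closure_Ico hpos.ne] at ht
    exact closure_minimal (t := γ ⁻¹' K) (fun t ht => hOK (hlt t ht)) (hKc.preimage hγc) ht
  obtain ⟨h1, h2⟩ := key t₁ hK1 t₁ ⟨hpos.le, le_rfl⟩
  refine ht₁O ⟨h1, ?_⟩
  rw [Set.mem_preimage, mem_ball_iff_norm]
  refine lt_of_le_of_lt (h2.trans ?_) h0ρ
  gcongr
  exact ht₁.2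

/-- The derivative of a flow at a zero of the vector field solves the linearized ODE. -/
theorem hasDerivAt_flow_of_linear_solution [BoundarylessManifold I M]
    {X : (x : M) → TangentSpace I x} {φ : ℝ → M → M} (hφ : IsFlow I X φ) {x₀ : M}
    {D : E →L[ℝ] E} (hX0 : chartField I X x₀ (extChartAt I x₀ x₀) = 0)
    (hD : HasFDerivAt (chartField I X x₀) D (extChartAt I x₀ x₀))
    {c : ℝ → E} (hc : ∀ t, HasDerivAt c (D (c t)) t) {T : ℝ} (hT : 0 ≤ T) :
    HasDerivAt (fun s : ℝ => extChartAt I x₀ (φ T ((extChartAt I x₀).symm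
      (extChartAt I x₀ x₀ + s • c 0)))) (c T) 0 := by
  set ψ := extChartAt I x₀ with hψ
  set p := ψ x₀
  set L := ‖D‖ + 1
  have hL : 0 ≤ L := by positivity
  have htarget : ψ.target ∈ nhds p := mem_interior_iff_mem_nhds.1
    (ModelWithCorners.isInteriorPoint_iff.1 (BoundarylessManifold.isInteriorPoint (I := I) (x := x₀)))
  have main : ∀ η, 0 < η → η ≤ 1 → ∀ᶠ s in nhds (0 : ℝ),
      ‖ψ (φ T (ψ.symm (p + s • c 0))) - p - s • c T‖ ≤
        η * (|s| * ‖c 0‖ * Real.exp (L * T)) * Real.exp (L * T) := by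
    intro η hη hη1
    have h1 : ∀ᶠ y in nhds p, y ∈ ψ.target ∧ ‖chartField I X x₀ y - D (y - p)‖ ≤ η * ‖y - p‖ := by
      refine Filter.Eventually.and htarget ?_
      simpa [hX0] using hD.isLittleO.def hη
    obtain ⟨ρ, hρ, hball⟩ := Metric.nhds_basis_closedBall.eventually_iff.1 h1
    have hbd : ∀ y ∈ Metric.closedBall p ρ, ‖chartField I X x₀ y‖ ≤ L * ‖y - p‖ := by
      intro y hy
      have e : chartField I X x₀ y = (chartField I X x₀ y - D (y - p)) + D (y - p) := by abel
      have h2 := (hball hy).2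
      have h3 := D.le_opNorm (y - p)
      have h4 : η * ‖y - p‖ ≤ 1 * ‖y - p‖ := by gcongr
      rw [e]
      refine (norm_add_le _ _).trans ?_
      simp only [L]
      linarith
    have hsmall : ∀ᶠ s in nhds (0 : ℝ), |s| * ‖c 0‖ * Real.exp (L * T) < ρ := by
      have : Filter.Tendsto (fun s : ℝ => |s| * ‖c 0‖ * Real.exp (L * T)) (nhds 0) (nhds 0) := by
        have : Continuous fun s : ℝ => |s| * ‖c 0‖ * Real.exp (L * T) := by fun_prop
        simpa using this.tendsto 0
      exact this.eventually (gt_mem_nhds hρ)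
    filter_upwards [hsmall] with s hs
    have hexp : 1 ≤ Real.exp (L * T) := Real.one_le_exp (mul_nonneg hL hT)
    have hnorm : ‖p + s • c 0 - p‖ = |s| * ‖c 0‖ := by
      rw [add_sub_cancel_left, norm_smul, Real.norm_eq_abs]
    have hy : p + s • c 0 ∈ ψ.target := by
      refine (hball ?_).1
      rw [mem_closedBall_iff_norm, hnorm]
      exact (le_mul_of_one_le_right (by positivity) hexp).trans hs.le
    have hψ0 : ψ (φ 0 (ψ.symm (p + s • c 0))) = p + s • c 0 := by
      rw [hφ.map_zero, ψ.right_inv hy]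
    have htrap := integralCurve_mem_source (T := T) hL (fun y hy => (hball hy).1) hbd
      (hφ.isIntegralCurve (ψ.symm (p + s • c 0)))
      (by rw [hφ.map_zero]; exact ψ.map_target hy) (by rw [← hψ, hψ0, hnorm]; exact hs)
    simp only [← hψ, hψ0] at htrap
    change ∀ t ∈ _, _ ∧ ‖_ - p‖ ≤ ‖p + s • c 0 - p‖ * _ at htrap
    rw [hnorm] at htrap
    have hM : ∀ t ∈ Set.Icc 0 T, ‖ψ (φ t (ψ.symm (p + s • c 0))) - p‖ ≤
        |s| * ‖c 0‖ * Real.exp (L * T) := by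
      intro t ht
      refine (htrap t ht).2.trans ?_
      gcongr
      exact ht.2
    exact norm_sub_linear_solution_le (u := fun t => ψ (φ t (ψ.symm (p + s • c 0))))
      (by positivity) hη.le
      (fun t ht => hasDerivAt_extChartAt_comp (hφ.isIntegralCurve _) x₀ (htrap t ht).1)
      (fun t ht => (hball (mem_closedBall_iff_norm.2 ((hM t ht).trans hs.le))).2)
      hM hc hψ0 T ⟨hT, le_rfl⟩
  have h00 : ψ (φ T (ψ.symm (p + (0 : ℝ) • c 0))) = p := by
    have := (main 1 one_pos le_rfl).self_of_nhds
    simpa [sub_eq_zero] using this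
  rw [hasDerivAt_iff_isLittleO_nhds_zero, Asymptotics.isLittleO_iff]
  intro ε hε
  set C := ‖c 0‖ * Real.exp (L * T) * Real.exp (L * T) + 1
  have hC : 0 < C := by positivity
  filter_upwards [main (min 1 (ε / C)) (by positivity) (min_le_left _ _)] with s hs
  simp only [zero_add, h00]
  refine hs.trans ?_
  have h1 : min 1 (ε / C) * C ≤ ε :=
    (mul_le_mul_of_nonneg_right (min_le_right _ _) hC.le).trans (div_mul_cancel₀ _ hC.ne').le
  have h2 : 0 ≤ min 1 (ε / C) := by positivity
  rw [Real.norm_eq_abs]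
  calc min 1 (ε / C) * (|s| * ‖c 0‖ * Real.exp (L * T)) * Real.exp (L * T)
      = (min 1 (ε / C) * (C - 1)) * |s| := by simp only [C]; ring
    _ ≤ ε * |s| := by gcongr; linarith [mul_sub (min 1 (ε / C)) C 1]

end ManifoldFlow

section Manifold

variable {E : Type*} [NormedAddCommGroup E] [NormedSpace ℝ E]
  {H : Type*} [TopologicalSpace H] {I : ModelWithCorners ℝ E H}
  {M : Type*} [TopologicalSpace M] [ChartedSpace H M]

theorem extChartAt_target_mem_nhds_of_boundaryless [BoundarylessManifold I M] (x : M) :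
    (extChartAt I x).target ∈ nhds (extChartAt I x x) :=
  mem_interior_iff_mem_nhds.1
    (ModelWithCorners.isInteriorPoint_iff.1 BoundarylessManifold.isInteriorPoint)

theorem mfderiv_apply_of_eq_id {f : M → M} (hf : f = id) (x : M) (v : E) :
    (mfderiv I I f x : E →L[ℝ] E) v = v := by
  subst hf
  rw [mfderiv_id]; rfl

theorem chartField_self {X : (y : M) → TangentSpace I y} {x : M} (hX1 : X x = 0) :
    chartField I X x (extChartAt I x x) = 0 := by
  rw [chartField, VectorField.mpullbackWithin_apply, extChartAt_to_inv, hX1, map_zero]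
  rfl

theorem hasDerivAt_extChartAt_line [BoundarylessManifold I M] {f : M → M} {x : M}
    (hf : MDifferentiableAt I I f x) (hfx : f x = x) (v : E) :
    HasDerivAt (fun s : ℝ => extChartAt I x (f ((extChartAt I x).symm (extChartAt I x x + s • v))))
      ((mfderiv I I f x : E →L[ℝ] E) v) 0 := by
  have h : HasFDerivWithinAt (extChartAt I (f x) ∘ f ∘ (extChartAt I x).symm)
    (mfderiv I I f x : E →L[ℝ] E) (Set.range I) (extChartAt I x x) := hf.hasMFDerivAt.2
  rw [hfx] at h
  have h' := h.hasFDerivAt (range_mem_nhds_isInteriorPoint BoundarylessManifold.isInteriorPoint)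
  have hl : HasDerivAt (fun s : ℝ => extChartAt I x x + s • v) v 0 := by
    simpa using ((hasDerivAt_id (0 : ℝ)).smul_const v).const_add (extChartAt I x x)
  exact HasFDerivAt.comp_hasDerivAt_of_eq 0 h' hl (by simp)

variable {F : Type*} [NormedAddCommGroup F] [NormedSpace ℝ F]
  {K : Type*} [TopologicalSpace K] {J : ModelWithCorners ℝ F K}
  {N : Type*} [TopologicalSpace N] [ChartedSpace K N] [IsManifold I 1 M] [IsManifold J 1 N]

/-- A map with vanishing derivative is constant on a connected manifold without boundary. -/
theorem eq_of_hasMFDerivAt_zero [BoundarylessManifold I M] [PreconnectedSpace M] {h : M → N}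
    (hh : ∀ x, HasMFDerivAt I J h x 0) (x y : M) : h x = h y := by
  refine IsLocallyConstant.apply_eq_of_preconnectedSpace ?_ x y
  rw [IsLocallyConstant.iff_eventually_eq]
  intro x
  set ψ := extChartAt I x
  set ψ' := extChartAt J (h x)
  have hcont : Continuous h := continuous_iff_continuousAt.2 fun z => (hh z).continuousAt
  have h1 : ψ.target ∩ ψ.symm ⁻¹' (h ⁻¹' ψ'.source) ∈ nhds (ψ x) := by
    refine Filter.inter_mem (extChartAt_target_mem_nhds_of_boundaryless x) ?_
    refine (continuousAt_extChartAt_symm x).preimage_mem_nhds ?_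
    refine hcont.continuousAt.preimage_mem_nhds ?_
    rw [extChartAt_to_inv]
    exact extChartAt_source_mem_nhds (h x)
  obtain ⟨ρ, hρ, hball⟩ := Metric.mem_nhds_iff.1 h1
  have hd : ∀ z ∈ Metric.ball (ψ x) ρ, HasFDerivAt (ψ' ∘ h ∘ ψ.symm) (0 : E →L[ℝ] F) z := by
    intro z hz
    have hr : Set.range I ∈ nhds z := by
      refine Filter.mem_of_superset (Metric.isOpen_ball.mem_nhds hz) fun w hw => ?_
      exact extChartAt_target_subset_range x (hball hw).1
    have d1 := (mdifferentiableWithinAt_extChartAt_symm (I := I) (hball hz).1).mdifferentiableAt hr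
    have d2 := (hh (ψ.symm z)).comp z d1.hasMFDerivAt
    have d3 : MDifferentiableAt J 𝓘(ℝ, F) ψ' (h (ψ.symm z)) :=
      mdifferentiableAt_extChartAt (by rw [← extChartAt_source (I := J)]; exact (hball hz).2)
    have d4 := hasMFDerivAt_iff_hasFDerivAt.1 (d3.hasMFDerivAt.comp z d2)
    refine d4.congr_fderiv ?_
    ext v
    exact map_zero (mfderiv J 𝓘(ℝ, F) ψ' (h (ψ.symm z)))
  have hconst : ∀ z ∈ Metric.ball (ψ x) ρ, (ψ' ∘ h ∘ ψ.symm) z = (ψ' ∘ h ∘ ψ.symm) (ψ x) := by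
    intro z hz
    refine Metric.isOpen_ball.is_const_of_fderiv_eq_zero
      (convex_ball (ψ x) ρ).isPreconnected
      (fun w hw => (hd w hw).differentiableAt.differentiableWithinAt)
      (fun w hw => (hd w hw).fderiv) hz (Metric.mem_ball_self hρ)
  have hsrc : ψ.source ∩ ψ ⁻¹' Metric.ball (ψ x) ρ ∈ nhds x :=
    Filter.inter_mem (extChartAt_source_mem_nhds x)
      ((continuousAt_extChartAt x).preimage_mem_nhds (Metric.ball_mem_nhds _ hρ))
  filter_upwards [hsrc] with w hw
  have e := hconst (ψ w) hw.2
  have hw' := (hball hw.2).2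
  simp only [Function.comp_apply, Set.mem_preimage, ψ.left_inv hw.1] at e hw'
  rw [extChartAt_to_inv] at e
  exact ψ'.injOn hw' (mem_extChartAt_source (h x)) e

end Manifold

section LieGroup

variable {E : Type*} [NormedAddCommGroup E] [NormedSpace ℝ E]
  {H : Type*} [TopologicalSpace H] {I : ModelWithCorners ℝ E H}
  {G : Type*} [TopologicalSpace G] [ChartedSpace H G] [Group G]

theorem mulInvariantVectorField_one (Y : GroupLieAlgebra I G) :
    (mulInvariantVectorField Y (1 : G) : E) = Y :=
  mfderiv_apply_of_eq_id (I := I) (by ext; simp) (1 : G) Y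

theorem mfderiv_one_eq_self_of_eventuallyEq {f : G →* G} (hf : ContMDiff I I ∞ f) {Y : E}
    {γ : ℝ → G} (h0 : γ 0 = 1)
    (hγ : IsMIntegralCurveAt (I := I) γ (mulInvariantVectorField (I := I) (G := G) Y) 0)
    (h : f ∘ γ =ᶠ[nhds 0] γ) : (mfderiv I I f 1 : E →L[ℝ] E) Y = Y := by
  have h1 := ((hf.mdifferentiable (by simp)) (γ 0)).hasMFDerivAt.comp 0 hγ.hasMFDerivAt
  have h2 := hasMFDerivAt_unique h1 (hγ.hasMFDerivAt.congr_of_eventuallyEq h)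
  have e1 : ∀ w : E, (ContinuousLinearMap.smulRight (1 : ℝ →L[ℝ] ℝ) w) 1 = w := fun w => by simp
  have h3 : (mfderiv I I f (γ 0) : E →L[ℝ] E)
      (mulInvariantVectorField (I := I) (G := G) Y (γ 0)) =
        mulInvariantVectorField (I := I) (G := G) Y (γ 0) :=
    ((congrArg (mfderiv I I f (γ 0) : E →L[ℝ] E) (e1 _)).symm.trans
      (congrArg (fun A : ℝ →L[ℝ] E => A 1) h2)).trans (e1 _)
  rw [h0] at h3
  have h4 := mulInvariantVectorField_one (I := I) (G := G) Y
  rwa [h4] at h3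

variable [LieGroup I ∞ G]

theorem mfderiv_mulInvariantVectorField {f : G →* G} (hf : ContMDiff I I ∞ f)
    (Y : GroupLieAlgebra I G) (g : G) :
    ((mfderiv I I f g : E →L[ℝ] E) (mulInvariantVectorField Y g) : E) =
      mulInvariantVectorField (I := I) (G := G) ((mfderiv I I f 1 : E →L[ℝ] E) Y) (f g) := by
  have hd : MDifferentiable I I f := hf.mdifferentiable (by simp)
  have hl : ∀ a : G, MDifferentiable I I (fun x => a * x) := fun a =>
    (contMDiff_mul_left (I := I) (n := ∞)).mdifferentiable (by simp)
  have e : (f ∘ fun x => g * x) = (fun x => f g * x) ∘ f := by ext x; simp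
  have h1 : HasMFDerivAt I I (f ∘ fun x => g * x) 1
      ((mfderiv I I f (g * 1) : E →L[ℝ] E).comp (mfderiv I I (fun x => g * x) 1 : E →L[ℝ] E)) :=
    (hd (g * 1)).hasMFDerivAt.comp 1 (hl g 1).hasMFDerivAt
  have h2 : HasMFDerivAt I I ((fun x => f g * x) ∘ f) 1
      ((mfderiv I I (fun x => f g * x) (f 1) : E →L[ℝ] E).comp (mfderiv I I f 1 : E →L[ℝ] E)) :=
    (hl (f g) (f 1)).hasMFDerivAt.comp 1 (hd 1).hasMFDerivAt
  rw [e, mul_one] at h1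
  rw [map_one] at h2
  have := congrArg (fun A : E →L[ℝ] E => A Y) (hasMFDerivAt_unique h1 h2)
  exact this

/-- A smooth endomorphism of a connected Lie group whose derivative at the identity is trivial is
the identity. -/
theorem eq_id_of_mfderiv_one_eq_id [BoundarylessManifold I G] [ConnectedSpace G] {f : G →* G}
    (hf : ContMDiff I I ∞ f) (h1 : ∀ v : E, (mfderiv I I f 1 : E →L[ℝ] E) v = v) (g : G) :
    f g = g := by
  set h : G → G := fun x => f x * x⁻¹ with hh
  have hh1 : h 1 = 1 := by simp [hh]
  have hs : ContMDiff I I ∞ h := hf.mul (contMDiff_id.inv)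
  have hd1 : HasMFDerivAt I I h 1 0 := by
    have hp : HasMFDerivAt I (I.prod I) (fun x => (h x, x)) 1 _ :=
      ((hs.mdifferentiable (by simp)) 1).hasMFDerivAt.prodMk (hasMFDerivAt_id 1)
    have hm : MDifferentiable (I.prod I) I (fun p : G × G => p.1 * p.2) :=
      (contMDiff_mul I ∞).mdifferentiable (by simp)
    have hc := HasMFDerivAt.comp (g := fun p : G × G => p.1 * p.2) (f := fun x => (h x, x))
      (1 : G) (hm (h 1, 1)).hasMFDerivAt hp
    have e : ((fun p : G × G => p.1 * p.2) ∘ fun x => (h x, x)) = f := by ext x; simp [hh]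
    have hu : ∀ v : E, (mfderiv (I.prod I) I (fun p : G × G => p.1 * p.2) (h 1, 1) : E × E →L[ℝ] E)
        ((mfderiv I I h 1 : E →L[ℝ] E) v, v) = (mfderiv I I f 1 : E →L[ℝ] E) v := by
      intro v
      rw [e] at hc
      exact congrArg (fun A : E →L[ℝ] E => A v)
        (hasMFDerivAt_unique hc (hf.mdifferentiable (by simp) 1).hasMFDerivAt)
    have hz : ∀ v : E, (mfderiv I I h 1 : E →L[ℝ] E) v = 0 := by
      intro v
      have h2 := hu v
      rw [h1] at h2
      have h3 := mfderiv_prod_eq_add_apply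
        (v := (((mfderiv I I h 1 : E →L[ℝ] E) v, v) : E × E)) (hm (h 1, 1))
      have h4 := mfderiv_apply_of_eq_id (I := I) (f := fun z : G => z * 1) (by ext; simp) (h 1)
        ((mfderiv I I h 1 : E →L[ℝ] E) v)
      have h5 := mfderiv_apply_of_eq_id (I := I) (f := fun z : G => h 1 * z)
        (by ext; simp [hh1]) 1 v
      obtain ⟨w, hw⟩ : ∃ w : E, w = (mfderiv I I h 1 : E →L[ℝ] E) v := ⟨_, rfl⟩
      have h6 : v = w + v :=
        h2.symm.trans (h3.trans (congrArg₂ (fun a b : E => a + b) (h4.trans hw.symm) h5))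
      rw [← hw]
      exact right_eq_add.1 h6
    have := ((hs.mdifferentiable (by simp)) 1).hasMFDerivAt
    convert! this using 1
    ext v
    exact (hz v).symm
  have hd : ∀ x, HasMFDerivAt I I h x 0 := by
    intro x
    have e : h = (fun y => f x * y * x⁻¹) ∘ h ∘ (fun y => x⁻¹ * y) := by
      ext y; simp [hh, mul_assoc]
    have hB : MDifferentiable I I (fun y : G => x⁻¹ * y) :=
      (contMDiff_mul_left (I := I) (n := ∞)).mdifferentiable (by simp)
    have hA : MDifferentiable I I (fun y : G => f x * y * x⁻¹) :=
      ((contMDiff_mul_right (I := I) (n := ∞) (a := x⁻¹)).comp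
        (contMDiff_mul_left (I := I) (n := ∞) (a := f x))).mdifferentiable (by simp)
    have hd1' : HasMFDerivAt I I h (x⁻¹ * x) 0 := by
      rw [inv_mul_cancel]; exact hd1
    have hc := (hA _).hasMFDerivAt.comp x (hd1'.comp x (hB x).hasMFDerivAt)
    rw [← e] at hc
    refine hc.congr_mfderiv ?_
    ext v
    exact map_zero (mfderiv I I (fun y : G => f x * y * x⁻¹) (h (x⁻¹ * x)))
  have hg := eq_of_hasMFDerivAt_zero hd g 1
  rw [hh1] at hg
  exact mul_inv_eq_one.1 hg

/-- The derivation of a vector field vanishing at the identity is its linearization there. -/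
theorem derivation_apply [FiniteDimensional ℝ E] [BoundarylessManifold I G]
    {X : (g : G) → TangentSpace I g} (hX1 : X 1 = 0) (Y : GroupLieAlgebra I G) :
    (derivation I X Y : E) = fderiv ℝ (chartField I X (1 : G)) (extChartAt I (1 : G) 1) Y := by
  change -VectorField.mlieBracket I X (mulInvariantVectorField Y) (1 : G) = _
  have e : ∀ w : E, (mfderiv I 𝓘(ℝ, E) (extChartAt I (1 : G)) 1 : E →L[ℝ] E).inverse w = w :=
    fun w => (congrArg (fun A : E →L[ℝ] E => A.inverse w) mfderiv_extChartAt_self).trans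
      (congrArg (fun A : E →L[ℝ] E => A w) ContinuousLinearMap.inverse_id)
  have h1 : chartField I X (1 : G) (extChartAt I (1 : G) 1) = 0 := chartField_self hX1
  have h2 : chartField I (mulInvariantVectorField Y) (1 : G) (extChartAt I (1 : G) 1) = Y := by
    have h : ∀ z : G, z = 1 → ∀ B : E →L[ℝ] E, B = ContinuousLinearMap.id ℝ E →
        B (mulInvariantVectorField Y z) = Y := by
      rintro _ rfl B rfl; exact mulInvariantVectorField_one Y
    exact h _ (extChartAt_to_inv 1) _
      ((congrArg (fun A : E →L[ℝ] E => A.inverse) mfderivWithin_range_extChartAt_symm).trans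
        ContinuousLinearMap.inverse_id)
  have h3 : Set.range I ∈ nhds (extChartAt I (1 : G) 1) :=
    range_mem_nhds_isInteriorPoint BoundarylessManifold.isInteriorPoint
  have key : ∀ (V W : E → E) (s : Set E) (p w : E), V p = 0 → W p = w → s ∈ nhds p →
      -VectorField.lieBracketWithin ℝ V W s p = fderiv ℝ V p w := by
    intro V W s p w hV hW hs
    rw [VectorField.lieBracketWithin, hV, hW, map_zero, zero_sub, neg_neg,
      fderivWithin_of_mem_nhds hs]
  exact (congrArg (fun w : E => -w) (e _)).trans (key (chartField I X (1 : G))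
    (chartField I (mulInvariantVectorField Y) (1 : G)) _ (extChartAt I (1 : G) 1) Y h1 h2
    (Filter.inter_mem Filter.univ_mem h3))

theorem hasFDerivAt_chartField [FiniteDimensional ℝ E] [BoundarylessManifold I G]
    {X : (g : G) → TangentSpace I g}
    (hX : ContMDiff I I.tangent ∞ (fun g => (⟨g, X g⟩ : TangentBundle I G))) (x : G) :
    HasFDerivAt (chartField I X x) (fderiv ℝ (chartField I X x) (extChartAt I x x))
      (extChartAt I x x) := by
  have := FiniteDimensional.complete ℝ E
  have : IsManifold I 2 G := IsManifold.of_le (n := ∞) ENat.LEInfty.out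
  have hd := MDifferentiableWithinAt.differentiableWithinAt_mpullbackWithin_vectorField
    ((hX.mdifferentiable (by simp)) x).mdifferentiableWithinAt (s := Set.univ)
  refine (hd.differentiableAt ?_).hasFDerivAt
  simpa using range_mem_nhds_isInteriorPoint (I := I) (x := x) BoundarylessManifold.isInteriorPoint

theorem eventuallyEq_comp_integralCurve [FiniteDimensional ℝ E] [BoundarylessManifold I G] {f : G →* G} (hf : ContMDiff I I ∞ f) {Y : E}
    (hY : (mfderiv I I f 1 : E →L[ℝ] E) Y = Y) {γ : ℝ → G} (h0 : γ 0 = 1)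
    (hγ : IsMIntegralCurveAt (I := I) γ (mulInvariantVectorField (I := I) (G := G) Y) 0) :
    f ∘ γ =ᶠ[nhds 0] γ := by
  have := FiniteDimensional.complete ℝ E
  have hv := (contMDiff_mulInvariantVectorField (I := I) (G := G) Y).of_le (m := 1)
    (by simp)
  refine isMIntegralCurveAt_eventuallyEq_of_contMDiffAt_boundaryless hv.contMDiffAt ?_ hγ
    (by simp [h0])
  refine hγ.mono fun t ht => ?_
  refine (((hf.mdifferentiable (by simp)) (γ t)).hasMFDerivAt.comp t ht).congr_mfderiv ?_
  ext
  have h := mfderiv_mulInvariantVectorField hf Y (γ t)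
  rw [hY] at h
  have e1 : ∀ w : E, (ContinuousLinearMap.smulRight (1 : ℝ →L[ℝ] ℝ) w) 1 = w := fun w => by simp
  exact ((congrArg (mfderiv I I f (γ t) : E →L[ℝ] E) (e1 _)).trans h).trans (e1 _).symm

end LieGroup

section LinearVectorField

variable {E : Type*} [NormedAddCommGroup E] [NormedSpace ℝ E] [FiniteDimensional ℝ E]
  {H : Type*} [TopologicalSpace H] {I : ModelWithCorners ℝ E H}
  {G : Type*} [TopologicalSpace G] [ChartedSpace H G] [Group G] [LieGroup I ∞ G]
  [BoundarylessManifold I G] [T2Space G] {X : (g : G) → TangentSpace I g} {φ : ℝ → G → G}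

theorem IsFlow.eq_of_isMIntegralCurve (hX : IsLinearVectorField I X) (hφ : IsFlow I X φ)
    {γ : ℝ → G} (hγ : IsMIntegralCurve (I := I) γ X) (t : ℝ) : γ t = φ t (γ 0) := by
  have := FiniteDimensional.complete ℝ E
  have h := isMIntegralCurve_Ioo_eq_of_contMDiff_boundaryless (t₀ := 0) (hX.1.of_le (by simp)) hγ
    (hφ.isIntegralCurve (γ 0)) (hφ.map_zero _).symm
  exact congrFun h t

theorem IsFlow.map_add (hX : IsLinearVectorField I X) (hφ : IsFlow I X φ) (t s : ℝ) (g : G) :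
    φ (t + s) g = φ t (φ s g) := by
  have h := hφ.eq_of_isMIntegralCurve hX ((hφ.isIntegralCurve g).comp_add s) t
  simpa using h

theorem IsFlow.exists_monoidHom (hX : IsLinearVectorField I X) (hφ : IsFlow I X φ) (t : ℝ) :
    ∃ f : G →* G, ⇑f = φ t ∧ ContMDiff I I ∞ f := by
  obtain ⟨ψ, hψ, haut⟩ := hX.2
  obtain ⟨e, he, hs, -⟩ := haut t
  refine ⟨e.toMonoidHom, ?_, hs⟩
  have h : ψ t = φ t := by
    ext g
    have := hφ.eq_of_isMIntegralCurve hX (hψ.isIntegralCurve g) t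
    rwa [hψ.map_zero] at this
  rw [← h, ← he]
  rfl

theorem IsFlow.map_one (hX : IsLinearVectorField I X) (hφ : IsFlow I X φ) (t : ℝ) : φ t 1 = 1 := by
  obtain ⟨f, hf, -⟩ := hφ.exists_monoidHom hX t
  rw [← hf, _root_.map_one]

theorem IsFlow.field_one (hX : IsLinearVectorField I X) (hφ : IsFlow I X φ) : X 1 = 0 := by
  have h1 := hφ.isIntegralCurve 1
  have e : (fun t => φ t (1 : G)) = fun _ => 1 := by ext t; exact hφ.map_one hX t
  rw [e] at h1
  have h2 := hasMFDerivAt_unique (h1 0) (hasMFDerivAt_const (I := 𝓘(ℝ, ℝ)) (I' := I) (1 : G) (0 : ℝ))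
  have h3 := congrArg (fun A : ℝ →L[ℝ] E => A 1) h2
  exact (one_smul ℝ (X 1 : E)).symm.trans h3

/-- The derivative at the identity of the flow of a linear vector field is the flow of the linear
ODE given by the associated derivation. -/
theorem IsFlow.mfderiv_one_apply (hX : IsLinearVectorField I X) (hφ : IsFlow I X φ) {c : ℝ → E}
    (hc : ∀ t, HasDerivAt c (derivation I X (c t) : E) t) {T : ℝ} (hT : 0 ≤ T) :
    (mfderiv I I (φ T) 1 : E →L[ℝ] E) (c 0) = c T := by
  have hX1 := hφ.field_one hX
  obtain ⟨f, hf, hs⟩ := hφ.exists_monoidHom hX T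
  have h1 := hasDerivAt_flow_of_linear_solution hφ (chartField_self hX1)
    (hasFDerivAt_chartField hX.1 1) (c := c)
    (fun t => (hc t).congr_deriv (derivation_apply hX1 (c t))) hT
  have h2 := hasDerivAt_extChartAt_line (f := φ T)
    ((hf ▸ hs : ContMDiff I I ∞ (φ T)).mdifferentiable (by simp) 1) (hφ.map_one hX T) (c 0)
  exact h2.unique h1

theorem IsFlow.mfderiv_one_of_derivation_eq_zero (hX : IsLinearVectorField I X)
    (hφ : IsFlow I X φ) {Y : E} (hY : (derivation I X Y : E) = 0) {T : ℝ} (hT : 0 ≤ T) :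
    (mfderiv I I (φ T) 1 : E →L[ℝ] E) Y = Y :=
  hφ.mfderiv_one_apply hX (c := fun _ => Y) (fun t => by rw [hY]; exact hasDerivAt_const t Y) hT

theorem IsFlow.mfderiv_one_of_derivation_sq (hX : IsLinearVectorField I X)
    (hφ : IsFlow I X φ) {Y Z : E} {a : ℝ} (ha : a ≠ 0) (hYZ : derivation I X Y = Z)
    (hZ : derivation I X Z = -(a ^ 2 • Y)) {T : ℝ} (hT : 0 ≤ T) :
    (mfderiv I I (φ T) 1 : E →L[ℝ] E) Y = Real.cos (a * T) • Y + (Real.sin (a * T) / a) • Z := by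
  obtain ⟨D, hD⟩ : ∃ D : E →ₗ[ℝ] E, D = derivation I X := ⟨_, rfl⟩
  have hD' : ∀ W : E, derivation I X W = D W := fun W => by rw [hD]; rfl
  have hDY : D Y = Z := (hD' Y).symm.trans hYZ
  have hDZ : D Z = -(a ^ 2 • Y) := (hD' Z).symm.trans hZ
  have h := hφ.mfderiv_one_apply hX
    (c := fun t => Real.cos (a * t) • Y + (Real.sin (a * t) / a) • Z) (fun t => by
      have e : D (Real.cos (a * t) • Y + (Real.sin (a * t) / a) • Z) =
          (-Real.sin (a * t) * a) • Y + (Real.cos (a * t) * a / a) • Z := by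
        rw [_root_.map_add, map_smul, map_smul, hDY, hDZ, mul_div_cancel_right₀ _ ha, smul_neg,
          smul_smul, add_comm, ← neg_smul]
        congr 2
        field_simp
      have h1 : HasDerivAt (fun t : ℝ => a * t) a t := by
        simpa using (hasDerivAt_id t).const_mul a
      refine HasDerivAt.congr_deriv ?_ (e.symm.trans (hD' _).symm)
      exact (h1.cos.smul_const Y).add ((h1.sin.div_const a).smul_const Z)) hT
  have e0 : Real.cos (a * 0) • Y + (Real.sin (a * 0) / a) • Z = Y := by simp
  exact (congrArg (mfderiv I I (φ T) 1 : E →L[ℝ] E) e0).symm.trans h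

/-- If the derivation is semisimple with purely imaginary eigenvalues that have a common period,
then the flow is periodic. -/
theorem IsFlow.eq_self_of_common_period [ConnectedSpace G] (hX : IsLinearVectorField I X)
    (hφ : IsFlow I X φ) {S : Set ℝ} (hS0 : ∀ a ∈ S, a ≠ 0)
    (hS : ∀ μ : ℂ, μ ≠ 0 → IsComplexEigenvalue (derivation I X) μ →
      ∃ a ∈ S, μ = (a : ℂ) * Complex.I ∨ μ = -((a : ℂ) * Complex.I))
    (hss : ∀ μ : ℂ, IsComplexEigenvalue (derivation I X) μ → IsSemisimpleAt (derivation I X) μ)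
    {T : ℝ} (hT : 0 ≤ T) (hST : ∀ a ∈ S, ∃ n : ℤ, a * T = n * (2 * Real.pi)) (g : G) :
    φ T g = g := by
  obtain ⟨f, hf, hs⟩ := hφ.exists_monoidHom hX T
  have hfin : FiniteDimensional ℝ (GroupLieAlgebra I G) := inferInstanceAs (FiniteDimensional ℝ E)
  obtain ⟨A, hA⟩ : ∃ A : E →L[ℝ] E, A = mfderiv I I (φ T) 1 := ⟨_, rfl⟩
  have hA' : ∀ Y : E, mfderiv I I (φ T) 1 Y = A Y := fun Y => by rw [hA]; rfl
  let N : E →ₗ[ℝ] E := (A - ContinuousLinearMap.id ℝ E : E →L[ℝ] E)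
  have hN : ∀ Y : E, N Y = A Y - Y := fun Y => rfl
  have hker : ∀ a ∈ S, ∀ Y Z : E, derivation I X Y = Z → derivation I X Z = -(a ^ 2 • Y) →
      N Y = 0 := by
    intro a ha Y Z hYZ hZ
    have h := (hA' Y).symm.trans (hφ.mfderiv_one_of_derivation_sq hX (hS0 a ha) hYZ hZ hT)
    obtain ⟨n, hn⟩ := hST a ha
    have hsin : Real.sin (n * (2 * Real.pi)) = 0 := by
      have := Real.sin_int_mul_pi (n * 2)
      push_cast at this
      rwa [mul_assoc] at this
    rw [hn, Real.cos_int_mul_two_pi, hsin, zero_div, zero_smul, add_zero, one_smul] at h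
    exact (hN Y).trans (sub_eq_zero.2 h)
  have hN0 : N = 0 := by
    refine eq_zero_of_ker_le (V := GroupLieAlgebra I G) (D := derivation I X) (N := N) hS hss ?_
      (fun a ha Y hY => hker a ha Y _ rfl hY)
    intro Y hY
    have h := (hA' Y).symm.trans (hφ.mfderiv_one_of_derivation_eq_zero hX (Y := Y) hY hT)
    exact (hN Y).trans (sub_eq_zero.2 h)
  rw [← hf]
  refine eq_id_of_mfderiv_one_eq_id hs (fun v => ?_) g
  have := hN v
  rw [hN0, LinearMap.zero_apply, eq_comm, sub_eq_zero] at this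
  rw [hf]
  exact (hA' v).trans this

/-- An imaginary eigenvalue of the derivation gives rise to a periodic orbit. -/
theorem IsFlow.exists_isPeriodicOrbit (hX : IsLinearVectorField I X) (hφ : IsFlow I X φ)
    {a : ℝ} (ha : a ≠ 0) (heig : IsComplexEigenvalue (derivation I X) (a * Complex.I)) :
    ∃ (g : G) (T : ℝ), IsPeriodicOrbit φ g T := by
  have := FiniteDimensional.complete ℝ E
  obtain ⟨Y, Z, hY0, hYZ, hZ⟩ : ∃ Y Z : E, Y ≠ 0 ∧ derivation I X Y = Z ∧
      derivation I X Z = -(a ^ 2 • Y) := by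
    obtain ⟨Y, hY0, hY⟩ := exists_apply_apply_eq_neg_sq_smul heig
    exact ⟨Y, _, hY0, rfl, hY⟩
  obtain ⟨ε, hε, haε⟩ : ∃ ε : ℝ, ε ^ 2 = 1 ∧ 0 < ε / a := by
    rcases lt_or_gt_of_ne ha with h | h
    · exact ⟨-1, by norm_num, div_pos_of_neg_of_neg (by norm_num) h⟩
    · exact ⟨1, by norm_num, div_pos one_pos h⟩
  have hε' : ε = 1 ∨ ε = -1 := by simpa using hε
  set t₀ := Real.pi * (ε / a)
  have ht₀ : 0 < t₀ := mul_pos Real.pi_pos haε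
  have hat : a * t₀ = ε * Real.pi := by simp only [t₀]; field_simp
  have hat2 : a * (2 * t₀) = ε * (2 * Real.pi) := by linear_combination 2 * hat
  have hc2 : Real.cos (a * (2 * t₀)) • Y + (Real.sin (a * (2 * t₀)) / a) • Z = Y := by
    rw [hat2]
    rcases hε' with h | h <;> simp [h]
  have hc1 : Real.cos (a * t₀) • Y + (Real.sin (a * t₀) / a) • Z = -Y := by
    rw [hat]
    rcases hε' with h | h <;> simp [h]
  have h2 : (mfderiv I I (φ (2 * t₀)) 1 : E →L[ℝ] E) Y = Y :=
    (hφ.mfderiv_one_of_derivation_sq hX ha hYZ hZ (by linarith)).trans hc2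
  have h1 : (mfderiv I I (φ t₀) 1 : E →L[ℝ] E) Y ≠ Y := by
    intro h
    have h' : Y = -Y :=
      h.symm.trans ((hφ.mfderiv_one_of_derivation_sq hX ha hYZ hZ ht₀.le).trans hc1)
    refine hY0 ?_
    rwa [eq_neg_iff_add_eq_zero, ← two_smul ℝ, smul_eq_zero_iff_right two_ne_zero] at h'
  obtain ⟨γ, h0, hγ⟩ := exists_isMIntegralCurveAt_of_contMDiffAt_boundaryless (I := I) (t₀ := 0)
    (x₀ := (1 : G)) (((contMDiff_mulInvariantVectorField (I := I) (G := G) Y).of_le (m := 1)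
    (by simp)).contMDiffAt)
  by_contra! hcon
  obtain ⟨f, hf, hs⟩ := hφ.exists_monoidHom hX (2 * t₀)
  obtain ⟨f₁, hf₁, hs₁⟩ := hφ.exists_monoidHom hX t₀
  rw [← hf] at h2
  rw [← hf₁] at h1
  have hev := eventuallyEq_comp_integralCurve hs h2 h0 hγ
  refine h1 (mfderiv_one_eq_self_of_eventuallyEq hs₁ h0 hγ ?_)
  filter_upwards [hev] with s hs
  rw [Function.comp_apply, hf] at hs
  by_contra hne
  refine hcon (γ s) (2 * t₀) ⟨fun hfix => hne ?_, by linarith, fun t => ?_⟩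
  · rw [Function.comp_apply, hf₁, hfix t₀]
  · rw [hφ.map_add hX, hs]

end LinearVectorField

end LinearFlow

theorem mainTheorem1
    {E : Type*} [NormedAddCommGroup E] [NormedSpace ℝ E] [FiniteDimensional ℝ E]
    {H : Type*} [TopologicalSpace H] (I : ModelWithCorners ℝ E H)
    {G : Type*} [TopologicalSpace G] [ChartedSpace H G] [Group G] [LieGroup I ∞ G]
    [BoundarylessManifold I G] [T2Space G] [ConnectedSpace G]
    (X : (g : G) → TangentSpace I g) (hX : LinearFlow.IsLinearVectorField I X)
    (φ : ℝ → G → G) (hφ : LinearFlow.IsFlow I X φ)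
    (r : ℕ) (α : Fin r → ℝ) (hα : ∀ j, α j ≠ 0)
    (heig : ∀ μ : ℂ, μ ≠ 0 →
      (LinearFlow.IsComplexEigenvalue (LinearFlow.derivation I X) μ ↔
        ∃ j, μ = (α j : ℂ) * Complex.I ∨ μ = -((α j : ℂ) * Complex.I)))
    (hss : ∀ μ : ℂ, μ ≠ 0 →
      LinearFlow.IsComplexEigenvalue (LinearFlow.derivation I X) μ →
        LinearFlow.IsSemisimpleAt (LinearFlow.derivation I X) μ)
    (hrat : ∀ i j, ∃ q : ℚ, α i / α j = (q : ℝ)) :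
    (1 ≤ r → ∃ (g : G) (T : ℝ), LinearFlow.IsPeriodicOrbit φ g T) ∧
    (LinearFlow.IsSemisimpleAt (LinearFlow.derivation I X) 0 →
      ∃ T : ℝ, 0 < T ∧ ∀ g : G, ¬ LinearFlow.IsFixedPoint φ g →
        LinearFlow.IsPeriodicOrbit φ g T) := by
  refine ⟨fun hr => ?_, fun h0 => ?_⟩
  · have hne : (α ⟨0, hr⟩ : ℂ) * Complex.I ≠ 0 :=
      mul_ne_zero (Complex.ofReal_ne_zero.2 (hα _)) Complex.I_ne_zero
    exact hφ.exists_isPeriodicOrbit hX (hα _) ((heig _ hne).2 ⟨_, Or.inl rfl⟩)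
  · obtain ⟨T, hT, hper⟩ := LinearFlow.exists_common_period hα hrat
    refine ⟨T, hT, fun g hg => ⟨hg, hT, fun t => ?_⟩⟩
    rw [hφ.map_add hX, hφ.eq_self_of_common_period hX (S := Set.range α)
      (Set.forall_mem_range.2 hα) (fun μ hμ h => ?_) (fun μ h => ?_) hT.le
      (Set.forall_mem_range.2 hper)]
    · obtain ⟨j, hj⟩ := (heig μ hμ).1 h
      exact ⟨α j, ⟨j, rfl⟩, hj⟩
    · rcases eq_or_ne μ 0 with rfl | hμ
      · exact h0
      · exact hss μ hμ h
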